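/- A \emph{bigraph} is a bipartite graph with partite sets $X,Y$. Let $\mathcal U$ be the set of all unit intervals $[a,a+1]$, $[a,a+1)$, $(a,a+1]$, $(a,a+1)$, $a\in\mathbb R$. A \emph{$\mathcal U$-representation} of a bigraph assigns to every vertex $v$ an interval $I(v)\in\mathcal U$ so that two vertices are adjacent if and only if they lie in different partite sets and their intervals intersect; a bigraph with a $\mathcal U$-representation is a \emph{mixed unit interval bigraph} ($\mathcal U$-bigraph). For $i\ge 1$ let $P'_i$ be the following bigraph. It has vertices $x_1'',x_2'',x_3'',y_1'',y_2'',y_3'',y_4''$; a path $p_1p_2\cdots p_i$, where $p_{2n-1}=x_n$ and $p_{2n}=y_n$, whose last vertex is called $u=p_i$; a pendant vertex $q_k$ adjacent to $p_k$ for each $1\le k\le i-1$ (so $q_{2n-1}=y_n'$ and $q_{2n}=x_n'$); and two special pendant vertices $v',v''$ adjacent to $u$. The remaining edges are $y_1''x_1''$, $y_1''x_2''$, $y_1''x_3''$, $y_1''x_1$, $y_2''x_2''$, $y_2''x_3''$, $y_2''x_1$, $y_3''x_2''$, $y_3''x_3''$, $y_4''x_3''$. The vertices named with $x$ lie in $X$,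 those named with $y$ in $Y$, and $v',v''$ lie in the partite set not containing $u$. The bigraph $P_i$ is obtained from $P'_i$ by adding two new vertices, one adjacent to $v'$ only and one adjacent to $v''$ only. Two $\mathcal U$-representations of a bigraph agree \emph{up to trivial modifications} if one arises from the other by a finite sequence of the following steps, each leading from a $\mathcal U$-representation of the bigraph to a $\mathcal U$-representation of it: shifting one interval; changing the type (which ends are open or closed) of one interval; reflecting the entire model about a point; translating the entire model; relabeling, i.e. permuting the vertices over the intervals, or permuting the intervals of the model among themselves (vertices having a common interval then keep a common interval). \textbf{Lemma.} Let $i\ge 1$. (a) $P'_i$ has the $\mathcal U$-representation $$I(x_1'')=(0,1),\quad I(y_1'')=I(x_2'')=[-\tfrac12,\tfrac12],\quad I(y_2'')=I(x_3'')=[-1,0],\quad I(y_3'')=[-\tfrac32,-\tfrac12],\quad I(y_4'')=[-2,-1],$$ $$I(x_n)=[2n-2,2n-1],\quad I(y_n)=[2n-1,2n],\quad I(y_n')=[2n-1,2n),\quad I(x_n')=[2n,2n+1)$$ (for those of these vertices that occur; in particular $I(u)=[i-1,i]$), where each of $I(v')$ and $I(v'')$ may be chosen as $[i,i+1]$ or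 as $[i,i+1)$, and every $\mathcal U$-representation of $P'_i$ agrees with it up to trivial modifications. (b) $P_i$ is a forbidden induced subgraph of mixed unit interval bigraphs: $P_i$ has no $\mathcal U$-representation, and no mixed unit interval bigraph contains $P_i$ as an induced subgraph. -/

import Mathlib

open Set

/-- A unit interval `⟨a, a + 1⟩` of the real line, where each of the two ends may be
closed or open. -/
@[ext]
structure MixedUnitInterval where
  /-- the left end point `a`; the right end point is `a + 1` -/
  left : ℝ
  /-- does the left end point belong to the interval? -/
  leftClosed : Bool
  /-- does the right end point belong to the interval? -/
  rightClosed : Bool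

namespace MixedUnitInterval

/-- The set of points of a mixed unit interval. -/
def toSet (J : MixedUnitInterval) : Set ℝ :=
  match J.leftClosed, J.rightClosed with
  | true, true => Icc J.left (J.left + 1)
  | true, false => Ico J.left (J.left + 1)
  | false, true => Ioc J.left (J.left + 1)
  | false, false => Ioo J.left (J.left + 1)

/-- `[a, a + 1]` -/
def cc (a : ℝ) : MixedUnitInterval := ⟨a, true, true⟩

/-- `[a, a + 1)` -/
def co (a : ℝ) : MixedUnitInterval := ⟨a, true, false⟩

/-- `(a, a + 1)` -/
def oo (a : ℝ) : MixedUnitInterval := ⟨a, false, false⟩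

/-- The translate of an interval by `t`. -/
def translate (t : ℝ) (J : MixedUnitInterval) : MixedUnitInterval :=
  ⟨J.left + t, J.leftClosed, J.rightClosed⟩

/-- The mirror image of an interval under the reflection `x ↦ 2 * p - x` about `p`. -/
def reflect (p : ℝ) (J : MixedUnitInterval) : MixedUnitInterval :=
  ⟨2 * p - (J.left + 1), J.rightClosed, J.leftClosed⟩

end MixedUnitInterval

/-- A bigraph `B = (X, Y, E)`: a simple graph together with a bipartition of its vertices;
`X` is the set of vertices with `side = true` and `Y` that of those with `side = false`. -/
structure Bigraph (V : Type*) where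
  graph : SimpleGraph V
  side : V → Bool
  bipartite : ∀ ⦃u v : V⦄, graph.Adj u v → side u ≠ side v

namespace Bigraph

/-- `I` is an intersection representation of `B` by mixed unit intervals: two vertices are
adjacent exactly when they belong to different partite sets and their intervals intersect. -/
def IsRepresentation {V : Type*} (B : Bigraph V) (I : V → MixedUnitInterval) : Prop :=
  ∀ u v : V, B.graph.Adj u v ↔
    B.side u ≠ B.side v ∧ ((I u).toSet ∩ (I v).toSet).Nonempty

/-- Mixed unit interval bigraphs. -/
def IsMixedUnitInterval {V : Type*} (B : Bigraph V) : Prop :=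
  ∃ I : V → MixedUnitInterval, B.IsRepresentation I

end Bigraph

/-- The elementary trivial modifications turning a family `I` of mixed unit intervals into a
family `I'`. -/
inductive TrivialStep {V : Type*} (I I' : V → MixedUnitInterval) : Prop
  /-- one interval is shifted, its type being kept -/
  | shift (v : V) (t : ℝ) (h : I' v = (I v).translate t) (h_ne : ∀ w, w ≠ v → I' w = I w)
  /-- the type (which ends are closed) of one interval is changed -/
  | changeType (v : V) (h : (I' v).left = (I v).left) (h_ne : ∀ w, w ≠ v → I' w = I w)
  /-- the entire model is reflected about a point -/
  | reflection (p : ℝ) (h : ∀ w, I' w = (I w).reflect p)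
  /-- the entire model is translated -/
  | translation (t : ℝ) (h : ∀ w, I' w = (I w).translate t)
  /-- the vertices are permuted over the intervals -/
  | relabelVertices (s : Equiv.Perm V) (h : ∀ w, I' w = I (s w))
  /-- the intervals of the model are permuted among themselves, vertices with a common interval
  keeping a common interval -/
  | relabelIntervals (s : Equiv.Perm MixedUnitInterval) (h : ∀ w, I' w = s (I w))
      (h_range : range I' = range I)

/-- Two families of intervals agree up to trivial modifications: one is obtained from the other
by a finite sequence of elementary trivial modifications, all of them between representations
of `B` (so that intersection and non-intersection of intervals of different partite sets are
preserved at every step). -/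
def TrivialEquiv {V : Type*} (B : Bigraph V) :
    (V → MixedUnitInterval) → (V → MixedUnitInterval) → Prop :=
  Relation.EqvGen fun I I' =>
    B.IsRepresentation I ∧ B.IsRepresentation I' ∧ TrivialStep I I'

/-- The vertices of the bigraph `P'_i`. -/
inductive PVertex (i : ℕ) : Type
  /-- `a1`, `a2`, `a3` are the vertices usually written `x₁''`, `x₂''`, `x₃''` -/
  | a1 | a2 | a3
  /-- `b1`, `b2`, `b3`, `b4` are the vertices usually written `y₁''`, `y₂''`, `y₃''`, `y₄''` -/
  | b1 | b2 | b3 | b4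
  /-- the path `x₁, y₁, x₂, y₂, …, u` on `i` vertices, numbered from `0` -/
  | path (k : Fin i)
  /-- the pendant vertices `y₁', x₁', y₂', x₂', …`, one for each vertex of the path but `u` -/
  | pend (k : Fin (i - 1))
  /-- the two special vertices `v'` and `v''` at the last vertex `u` of the path -/
  | special (b : Bool)

namespace PVertex

/-- The edges of `P'_i`, each listed in one direction. -/
def Edge {i : ℕ} : PVertex i → PVertex i → Prop
  | b1, a1 => True
  | b1, a2 => True
  | b1, a3 => True
  | b1, path k => (k : ℕ) = 0
  | b2, a2 => True
  | b2, a3 => True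
  | b2, path k => (k : ℕ) = 0
  | b3, a2 => True
  | b3, a3 => True
  | b4, a3 => True
  | path k, path l => (k : ℕ) + 1 = l
  | path k, pend l => (k : ℕ) = l
  | path k, special _ => (k : ℕ) + 1 = i
  | _, _ => False

/-- The partite set `X` consists of the vertices of `P'_i` with `side = true`. -/
def side {i : ℕ} : PVertex i → Bool
  | a1 => true
  | a2 => true
  | a3 => true
  | b1 => false
  | b2 => false
  | b3 => false
  | b4 => false
  | path k => decide ((k : ℕ) % 2 = 0)
  | pend k => decide ((k : ℕ) % 2 = 1)
  | special _ => decide (i % 2 = 0)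

theorem side_ne_of_edge {i : ℕ} : ∀ u v : PVertex i, Edge u v → side u ≠ side v := by
  intro u v h
  cases u <;> cases v <;> simp only [Edge] at h <;> simp [side] <;> omega

/-- The intervals of the standard representation of `P'_i`; the right ends of the intervals
`⟨i, i + 1⟩` of the two special vertices are closed or open according to `c`. -/
noncomputable def stdRep (i : ℕ) (c : Bool → Bool) : PVertex i → MixedUnitInterval
  | a1 => .oo 0
  | a2 => .cc (-1 / 2)
  | a3 => .cc (-1)
  | b1 => .cc (-1 / 2)
  | b2 => .cc (-1)
  | b3 => .cc (-3 / 2)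
  | b4 => .cc (-2)
  | path k => .cc ((k : ℕ) : ℝ)
  | pend k => .co (((k : ℕ) : ℝ) + 1)
  | special b => if c b then .cc (i : ℝ) else .co (i : ℝ)

end PVertex

/-- The bigraph `P'_i`. -/
def bigraphP' (i : ℕ) : Bigraph (PVertex i) where
  graph := SimpleGraph.fromRel PVertex.Edge
  side := PVertex.side
  bipartite := by
    intro u v h
    rcases h.2 with h | h
    · exact PVertex.side_ne_of_edge u v h
    · exact (PVertex.side_ne_of_edge v u h).symm

/-- The edges of `P_i`, each listed in one direction: those of `P'_i` and, for each of the two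
special vertices of `P'_i`, an edge to a new pendant vertex. -/
def PEdge {i : ℕ} : PVertex i ⊕ Bool → PVertex i ⊕ Bool → Prop
  | .inl u, .inl v => PVertex.Edge u v
  | .inl (.special b), .inr d => b = d
  | _, _ => False

/-- The partite set `X` consists of the vertices of `P_i` with `PSide = true`. -/
def PSide {i : ℕ} : PVertex i ⊕ Bool → Bool
  | .inl u => PVertex.side u
  | .inr _ => decide (i % 2 = 1)

theorem PSide_ne_of_edge {i : ℕ} : ∀ u v : PVertex i ⊕ Bool, PEdge u v → PSide u ≠ PSide v := by
  rintro (u | u) (v | v) h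
  · exact PVertex.side_ne_of_edge u v h
  · cases u <;> simp only [PEdge] at h
    simp [PSide, PVertex.side]
    omega
  · exact h.elim
  · exact h.elim

/-- The bigraph `P_i`. -/
def bigraphP (i : ℕ) : Bigraph (PVertex i ⊕ Bool) where
  graph := SimpleGraph.fromRel PEdge
  side := PSide
  bipartite := by
    intro u v h
    rcases h.2 with h | h
    · exact PSide_ne_of_edge u v h
    · exact (PSide_ne_of_edge v u h).symm

/-! Disjoint unit intervals are linearly ordered, and a chain of such comparisons closed up by
intersections turns into equalities that also fix the types of the touching ends. Reflect a
representation so that `b2` precedes `a1`, and let `w` be a neighbour, outside the head, of the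
first path vertex `p`. If `a1` precedes `w`, then `p`, which meets both `b2` and `w`, bridges
exactly the room of `a1`: `b2`, `p`, `w` lie end to end with closed contacts, and `a1` is the
interior of `p`. If `w` precedes `a1`, then `w` is forced to be the open unit interval between `a3`
and `a1`. This dichotomy is `HeadPattern.aligned_or_enclosed`.

The aligned shape propagates along the path (`path_eq_of_aligned`). The next path vertex and the
pendant vertex of the current one start at the same closed point. Any forward neighbour of the
former misses the latter, so it can only touch at the right end, where the path interval is closed
and the pendant one open. In the enclosed shape all choices of `w` share one interval, which is
possible only for `i = 1`.

For (a), the intervals left free by a shape are shifted one by one into a common general position,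
where their types are immaterial; hence any two models of one shape are equivalent. For `i = 1`, one
model of each shape uses the same set of intervals, and a permutation of intervals links the two.

For (b), in the aligned shape the two special vertices start at the same closed point. The private
neighbour of each forces that one to be right-closed and the other right-open, which is absurd; in
the enclosed shape they have the same interval. Since `P_i` is connected, a host graph induces its
bipartition up to exchange (`ne_iff_PSide_ne`), so non-representability passes to induced
containment. -/

namespace MixedUnitInterval

/-! ### Intersection in terms of end points and types -/

/-- Two mixed unit intervals intersect, in terms of their ends. -/
def Meets (J K : MixedUnitInterval) : Prop :=
  (J.left < K.left + 1 ∧ K.left < J.left + 1) ∨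
  (J.left + 1 = K.left ∧ J.rightClosed = true ∧ K.leftClosed = true) ∨
  (K.left + 1 = J.left ∧ K.rightClosed = true ∧ J.leftClosed = true)

theorem Meets.symm {J K : MixedUnitInterval} (h : J.Meets K) : K.Meets J := by
  rcases h with h | h | h
  · exact Or.inl ⟨h.2, h.1⟩
  · exact Or.inr (Or.inr h)
  · exact Or.inr (Or.inl h)

theorem mem_toSet {J : MixedUnitInterval} {x : ℝ} :
    x ∈ J.toSet ↔ (J.left < x ∨ J.left = x ∧ J.leftClosed = true) ∧
      (x < J.left + 1 ∨ x = J.left + 1 ∧ J.rightClosed = true) := by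
  rcases J with ⟨a, _ | _, _ | _⟩ <;> simp [toSet, le_iff_lt_or_eq]

theorem inter_nonempty_iff {J K : MixedUnitInterval} :
    (J.toSet ∩ K.toSet).Nonempty ↔ J.Meets K := by
  constructor
  · rintro ⟨x, hJ, hK⟩
    rw [mem_toSet] at hJ hK
    unfold Meets
    grind
  · rintro (⟨h1, h2⟩ | ⟨h1, h2, h3⟩ | ⟨h1, h2, h3⟩)
    · refine ⟨(J.left + K.left + 1) / 2, ?_, ?_⟩ <;> rw [mem_toSet] <;>
        exact ⟨Or.inl (by linarith), Or.inl (by linarith)⟩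
    · refine ⟨K.left, ?_, ?_⟩ <;> rw [mem_toSet]
      · exact ⟨Or.inl (by linarith), Or.inr ⟨h1.symm, h2⟩⟩
      · exact ⟨Or.inr ⟨rfl, h3⟩, Or.inl (by linarith)⟩
    · refine ⟨J.left, ?_, ?_⟩ <;> rw [mem_toSet]
      · exact ⟨Or.inr ⟨rfl, h3⟩, Or.inl (by linarith)⟩
      · exact ⟨Or.inl (by linarith), Or.inr ⟨h1.symm, h2⟩⟩

theorem Meets.le {J K : MixedUnitInterval} (h : J.Meets K) :
    J.left ≤ K.left + 1 ∧ K.left ≤ J.left + 1 := by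
  rcases h with ⟨h, h'⟩ | ⟨h, -⟩ | ⟨h, -⟩ <;> constructor <;> linarith

theorem Meets.closed {J K : MixedUnitInterval} (h : J.Meets K) :
    (J.left + 1 = K.left → J.rightClosed = true ∧ K.leftClosed = true) ∧
      (K.left + 1 = J.left → K.rightClosed = true ∧ J.leftClosed = true) := by
  simp only [Meets] at h
  grind

theorem le_or_le_of_not_meets {J K : MixedUnitInterval} (h : ¬ J.Meets K) :
    J.left + 1 ≤ K.left ∨ K.left + 1 ≤ J.left := by
  simp only [Meets] at h
  grind

theorem not_closed_of_not_meets {J K : MixedUnitInterval} (h : ¬ J.Meets K) :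
    (J.left + 1 = K.left → ¬ (J.rightClosed = true ∧ K.leftClosed = true)) ∧
      (K.left + 1 = J.left → ¬ (K.rightClosed = true ∧ J.leftClosed = true)) := by
  simp only [Meets] at h
  grind

theorem translate_meets_iff {J K : MixedUnitInterval} (t : ℝ) :
    (J.translate t).Meets (K.translate t) ↔ J.Meets K := by
  simp only [Meets, translate]
  grind

theorem reflect_meets_iff {J K : MixedUnitInterval} (p : ℝ) :
    (J.reflect p).Meets (K.reflect p) ↔ J.Meets K := by
  simp only [Meets, reflect]
  grind

/-- If `p` and `q` start at a common closed end, a unit interval that meets `p` but not `q`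
touches `p` at its right end. -/
theorem touch_of_meets_of_not_meets {p q n : MixedUnitInterval} (hpq : p.left = q.left)
    (hp : p.leftClosed = true) (hq : q.leftClosed = true) (hpn : p.Meets n) (hqn : ¬ q.Meets n) :
    n.left = p.left + 1 ∧ p.rightClosed = true ∧ n.leftClosed = true ∧
      q.rightClosed = false := by
  simp only [Meets] at hpn hqn
  grind

/-! ### The two possible shapes of the head -/

/-- The intersection pattern of the head of `P'_i`, with `p` the first vertex of the path
and `w` a further neighbour of `p`. -/
structure HeadPattern (a1 a2 a3 b1 b2 b3 b4 p w : MixedUnitInterval) : Prop where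
  a1b1 : a1.Meets b1
  a1b2 : ¬ a1.Meets b2
  a1b3 : ¬ a1.Meets b3
  a1b4 : ¬ a1.Meets b4
  a1w : ¬ a1.Meets w
  a2b1 : a2.Meets b1
  a2b2 : a2.Meets b2
  a2b3 : a2.Meets b3
  a2b4 : ¬ a2.Meets b4
  a2w : ¬ a2.Meets w
  a3b1 : a3.Meets b1
  a3b2 : a3.Meets b2
  a3b3 : a3.Meets b3
  a3b4 : a3.Meets b4
  a3w : ¬ a3.Meets w
  pb1 : p.Meets b1
  pb2 : p.Meets b2
  pb3 : ¬ p.Meets b3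
  pb4 : ¬ p.Meets b4
  pw : p.Meets w

/-- The first shape of the head: `b2`, `p` and `w` are placed end to end. -/
structure AlignedHead (a1 a2 a3 b1 b2 b3 b4 p w : MixedUnitInterval) : Prop where
  a1_left : a1.left = p.left
  a1_lc : a1.leftClosed = false
  a1_rc : a1.rightClosed = false
  b2_left : b2.left = p.left - 1
  b2_rc : b2.rightClosed = true
  p_lc : p.leftClosed = true
  p_rc : p.rightClosed = true
  w_left : w.left = p.left + 1
  w_lc : w.leftClosed = true

/-- The second shape of the head: `w` is open and placed between `a3` and `a1`. -/
structure EnclosedHead (a1 a2 a3 b1 b2 b3 b4 p w : MixedUnitInterval) : Prop where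
  a1_left : a1.left = a3.left + 2
  a1_lc : a1.leftClosed = true
  a2_left : a2.left = a3.left
  a2_lc : a2.leftClosed = false
  a2_rc : a2.rightClosed = true
  a3_lc : a3.leftClosed = true
  a3_rc : a3.rightClosed = true
  b1_left : b1.left = a3.left + 1
  b1_lc : b1.leftClosed = true
  b1_rc : b1.rightClosed = true
  b4_left : b4.left = a3.left - 1
  b4_rc : b4.rightClosed = true
  w_left : w.left = a3.left + 1
  w_lc : w.leftClosed = false
  w_rc : w.rightClosed = false
  p_gt : a3.left < p.left
  p_lt : p.left < a3.left + 2
  b3_gt : a3.left - 1 < b3.left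
  b3_le : b3.left ≤ p.left - 1
  b2_le : b2.left ≤ a3.left + 1

/-- The side of `a1` on which `w` lies decides the shape. Order information gives linear
inequalities that collapse to equalities; the types then follow from which of the touching pairs
meet. -/
theorem HeadPattern.aligned_or_enclosed {a1 a2 a3 b1 b2 b3 b4 p w : MixedUnitInterval}
    (h : HeadPattern a1 a2 a3 b1 b2 b3 b4 p w) (h0 : b2.left + 1 ≤ a1.left) :
    AlignedHead a1 a2 a3 b1 b2 b3 b4 p w ∨ EnclosedHead a1 a2 a3 b1 b2 b3 b4 p w := by
  have l1 := h.a1b1.le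
  have l2 := h.a2b1.le
  have l3 := h.a2b2.le
  have l4 := h.a2b3.le
  have l5 := h.a3b1.le
  have l6 := h.a3b2.le
  have l7 := h.a3b3.le
  have l8 := h.a3b4.le
  have l9 := h.pb1.le
  have l10 := h.pb2.le
  have l11 := h.pw.le
  have c1 := h.a1b1.closed
  have c2 := h.a2b1.closed
  have c3 := h.a2b2.closed
  have c4 := h.a2b3.closed
  have c5 := h.a3b1.closed
  have c6 := h.a3b2.closed
  have c7 := h.a3b3.closed
  have c8 := h.a3b4.closed
  have c9 := h.pb1.closed
  have c10 := h.pb2.closed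
  have c11 := h.pw.closed
  have n1 := not_closed_of_not_meets h.a1b2
  have n2 := not_closed_of_not_meets h.a1b3
  have n3 := not_closed_of_not_meets h.a1b4
  have n4 := not_closed_of_not_meets h.a1w
  have n5 := not_closed_of_not_meets h.a2b4
  have n6 := not_closed_of_not_meets h.a2w
  have n7 := not_closed_of_not_meets h.a3w
  have n8 := not_closed_of_not_meets h.pb3
  have n9 := not_closed_of_not_meets h.pb4
  rcases le_or_le_of_not_meets h.a1w with hw | hw
  · left
    -- `p.left ≤ b2.left + 1 ≤ a1.left ≤ w.left - 1 ≤ p.left`, so equality holds throughout.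
    constructor <;> grind
  right
  rcases le_or_le_of_not_meets h.a3w with ha | ha
  -- `a3.left + 2 ≤ w.left + 1 ≤ a1.left ≤ b1.left + 1 ≤ a3.left + 2` collapses likewise.
  · have e1 : a1.left = a3.left + 2 := by linarith
    have e2 : w.left = a3.left + 1 := by linarith
    have e3 : b1.left = a3.left + 1 := by linarith
    obtain ⟨a1_lc, b1_rc⟩ : a1.leftClosed = true ∧ b1.rightClosed = true := by grind
    obtain ⟨a3_rc, b1_lc⟩ : a3.rightClosed = true ∧ b1.leftClosed = true := by grind
    have w_lc : w.leftClosed = false := by grind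
    have w_rc : w.rightClosed = false := by grind
    have p_gt : a3.left < p.left := by grind
    have p_lt : p.left < a3.left + 2 := by grind
    have e5 : b4.left ≤ p.left - 1 := by
      rcases le_or_le_of_not_meets h.pb4 with h | h <;> linarith
    have e6 : b4.left + 1 ≤ a2.left := by
      rcases le_or_le_of_not_meets h.a2b4 with h | h <;> linarith
    have e7 : b3.left ≤ p.left - 1 := by
      rcases le_or_le_of_not_meets h.pb3 with h | h <;> linarith
    have e8 : a2.left + 1 ≤ w.left := by
      rcases le_or_le_of_not_meets h.a2w with h | h <;> linarith
    have e9 : a2.left = a3.left := by linarith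
    have e10 : b4.left = a3.left - 1 := by linarith
    obtain ⟨b4_rc, a3_lc⟩ : b4.rightClosed = true ∧ a3.leftClosed = true := by grind
    have a2_lc : a2.leftClosed = false := by grind
    have a2_rc : a2.rightClosed = true := by grind
    have b3_gt : a3.left - 1 < b3.left := by grind
    have b2_le : b2.left ≤ a3.left + 1 := by linarith
    constructor <;> assumption
  -- Now `w` precedes both `a1` and `a3`, which pushes `b3` and `b4` to the right of `p`. On either
  -- side of `a1`, they start at the same point, and their forced types leave `a2` no way to meet
  -- `b3` but not `b4`.
  · exfalso
    have hb4 : p.left + 1 ≤ b4.left := by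
      rcases le_or_le_of_not_meets h.pb4 with h | h
      · exact h
      · grind
    have hb3 : p.left + 1 ≤ b3.left := by
      rcases le_or_le_of_not_meets h.pb3 with h | h
      · exact h
      · grind
    rcases le_or_le_of_not_meets h.a1b4 with h' | h'
    · have : b4.left = a3.left + 1 := by linarith
      have : a1.left = a3.left := by linarith
      have : b3.left = b4.left := by
        rcases le_or_le_of_not_meets h.a1b3 with h | h
        · linarith
        · have : b2.left = p.left + 1 := by linarith
          have : a1.left = p.left + 2 := by linarith
          grind
      have : a2.left = a3.left := by
        rcases le_or_le_of_not_meets h.a2b4 with h | h <;> linarith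
      grind
    · have : b4.left = b1.left := by linarith
      have : a1.left = b1.left + 1 := by linarith
      have : b1.left = p.left + 1 := by linarith
      have : b3.left = b4.left := by
        rcases le_or_le_of_not_meets h.a1b3 with h | h
        · have : b2.left = p.left + 1 := by linarith
          have : a3.left = b2.left + 1 := by linarith
          grind
        · linarith
      have : b4.leftClosed = false ∧ b4.rightClosed = false := by grind
      have : b3.leftClosed = false ∧ b3.rightClosed = false := by grind
      exact h.a2b4 (by simpa [Meets, *] using h.a2b3)

end MixedUnitInterval

open MixedUnitInterval

namespace MixedUnitInterval

theorem not_meets_of_lt {J K : MixedUnitInterval} (h : J.left + 1 < K.left) : ¬ J.Meets K :=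
  fun h' => by linarith [h'.le.2]

theorem not_meets_of_gt {J K : MixedUnitInterval} (h : K.left + 1 < J.left) : ¬ J.Meets K :=
  fun h' => by linarith [h'.le.1]

theorem meets_of_lt {J K : MixedUnitInterval} (h : J.left < K.left + 1)
    (h' : K.left < J.left + 1) : J.Meets K :=
  Or.inl ⟨h, h'⟩

theorem meets_natCast_iff {m n : ℕ} {r s : Bool} :
    Meets ⟨m, true, r⟩ ⟨n, true, s⟩ ↔
      m = n ∨ (m + 1 = n ∧ r = true) ∨ (n + 1 = m ∧ s = true) := by
  simp only [Meets, and_true]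
  norm_cast
  grind

end MixedUnitInterval


/-! ### Transport of representations and elementary equivalences -/

namespace Bigraph

variable {V W : Type*} {B : Bigraph V} {I : V → MixedUnitInterval}

theorem isRepresentation_iff :
    B.IsRepresentation I ↔
      ∀ u v, B.graph.Adj u v ↔ B.side u ≠ B.side v ∧ (I u).Meets (I v) := by
  simp only [IsRepresentation, inter_nonempty_iff]

theorem IsRepresentation.translate (h : B.IsRepresentation I) (t : ℝ) :
    B.IsRepresentation fun v => (I v).translate t := by
  rw [isRepresentation_iff] at h ⊢
  simpa only [translate_meets_iff] using h

theorem IsRepresentation.reflect (h : B.IsRepresentation I) (p : ℝ) :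
    B.IsRepresentation fun v => (I v).reflect p := by
  rw [isRepresentation_iff] at h ⊢
  simpa only [reflect_meets_iff] using h

/-- Only whether two sides differ matters, so `f` is allowed to exchange the partite sets. -/
theorem IsRepresentation.comp {C : Bigraph W} {f : W → V} (h : B.IsRepresentation I)
    (hadj : ∀ u v, C.graph.Adj u v ↔ B.graph.Adj (f u) (f v))
    (hside : ∀ u v, C.side u ≠ C.side v ↔ B.side (f u) ≠ B.side (f v)) :
    C.IsRepresentation (I ∘ f) := by
  intro u v
  rw [hadj, hside]
  exact h (f u) (f v)

end Bigraph

namespace TrivialEquiv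

variable {V : Type*} {B : Bigraph V} {I I' I'' : V → MixedUnitInterval}

theorem symm (h : TrivialEquiv B I I') : TrivialEquiv B I' I := Relation.EqvGen.symm _ _ h

theorem trans (h : TrivialEquiv B I I') (h' : TrivialEquiv B I' I'') : TrivialEquiv B I I'' :=
  Relation.EqvGen.trans _ _ _ h h'

theorem translate (h : B.IsRepresentation I) (t : ℝ) :
    TrivialEquiv B I fun v => (I v).translate t :=
  .rel _ _ ⟨h, h.translate t, .translation t fun _ => rfl⟩

theorem reflect (h : B.IsRepresentation I) (p : ℝ) :
    TrivialEquiv B I fun v => (I v).reflect p :=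
  .rel _ _ ⟨h, h.reflect p, .reflection p fun _ => rfl⟩

/-- One interval is shifted, or its type is changed. -/
theorem of_single (h : B.IsRepresentation I) (h' : B.IsRepresentation I') (v : V)
    (hv : (I' v).left = (I v).left ∨
      (I' v).leftClosed = (I v).leftClosed ∧ (I' v).rightClosed = (I v).rightClosed)
    (h_ne : ∀ w, w ≠ v → I' w = I w) : TrivialEquiv B I I' := by
  refine .rel _ _ ⟨h, h', ?_⟩
  rcases hv with hv | hv
  · exact .changeType v hv h_ne
  · refine .shift v ((I' v).left - (I v).left) ?_ h_ne
    ext <;> simp [MixedUnitInterval.translate, hv]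

end TrivialEquiv

namespace PVertex

variable {i : ℕ} {I : PVertex i → MixedUnitInterval}

theorem isRepresentation_iff :
    (bigraphP' i).IsRepresentation I ↔
      (∀ u v, Edge u v → (I u).Meets (I v)) ∧
      ∀ u v, side u = true → side v = false → ¬ Edge u v → ¬ Edge v u →
        ¬ (I u).Meets (I v) := by
  rw [Bigraph.isRepresentation_iff]
  constructor
  · intro h
    refine ⟨fun u v huv => ?_, fun u v hu hv huv hvu hm => ?_⟩
    · refine ((h u v).1 ⟨?_, Or.inl huv⟩).2
      rintro rfl
      exact side_ne_of_edge u u huv rfl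
    · rcases ((h u v).2 ⟨by simp [bigraphP', hu, hv], hm⟩).2 with h | h
      exacts [huv h, hvu h]
  · rintro ⟨h1, h2⟩ u v
    constructor
    · intro huv
      refine ⟨(bigraphP' i).bipartite huv, ?_⟩
      rcases huv.2 with h | h
      exacts [h1 u v h, (h1 v u h).symm]
    · rintro ⟨hs, hm⟩
      refine ⟨fun h => hs (h ▸ rfl), ?_⟩
      by_contra hE
      simp only [not_or] at hE
      change side u ≠ side v at hs
      cases hu : side u <;> cases hv : side v
      · simp [hu, hv] at hs
      · exact h2 v u hv hu hE.2 hE.1 hm.symm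
      · exact h2 u v hu hv hE.1 hE.2 hm
      · simp [hu, hv] at hs

theorem meets_of_edge (h : (bigraphP' i).IsRepresentation I) {u v : PVertex i} (huv : Edge u v) :
    (I u).Meets (I v) :=
  (isRepresentation_iff.1 h).1 u v huv

theorem not_meets_of_not_edge (h : (bigraphP' i).IsRepresentation I) {u v : PVertex i}
    (hs : side u ≠ side v) (huv : ¬ Edge u v) (hvu : ¬ Edge v u) : ¬ (I u).Meets (I v) := by
  cases hu : side u <;> cases hv : side v
  · simp [hu, hv] at hs
  · exact fun hm => (isRepresentation_iff.1 h).2 v u hv hu hvu huv hm.symm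
  · exact (isRepresentation_iff.1 h).2 u v hu hv huv hvu
  · simp [hu, hv] at hs

/-! ### The aligned and enclosed families of models -/

/-- The representations of `P'_i` that place the vertices of the path end to end; only the
places of `a2`, `a3`, `b1`, `b3` and `b4` and some types are free. -/
noncomputable def alignedModel (i : ℕ) (d : Bool) (c : Bool → Bool)
    (A2 A3 B1 B3 B4 : MixedUnitInterval) : PVertex i → MixedUnitInterval
  | a1 => .oo 0
  | a2 => A2
  | a3 => A3
  | b1 => B1
  | b2 => ⟨-1, d, true⟩
  | b3 => B3
  | b4 => B4
  | path k => .cc ((k : ℕ) : ℝ)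
  | pend k => .co (((k : ℕ) : ℝ) + 1)
  | special b => ⟨(i : ℝ), true, c b⟩

/-- The conditions on the free intervals of `alignedModel`. -/
structure AlignedCond (A2 A3 B1 B3 B4 : MixedUnitInterval) : Prop where
  b1_gt : -1 < B1.left
  a2_lt : A2.left < 0
  a3_lt : A3.left < 0
  a2b1 : A2.Meets B1
  a3b1 : A3.Meets B1
  a2b3 : A2.Meets B3
  a3b3 : A3.Meets B3
  a3b4 : A3.Meets B4
  a2b4 : ¬ A2.Meets B4
  b3_le : B3.left ≤ -1
  b3_rc : B3.left = -1 → B3.rightClosed = false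
  b4_lt : B4.left < -1

/-- Outside the head all intervals are left-closed and start at natural numbers, so their
intersections reduce to arithmetic of indices; pairs involving the head are settled by order and by
a few contacts. -/
theorem isRepresentation_alignedModel (hi : 1 ≤ i) {d : Bool} {c : Bool → Bool}
    {A2 A3 B1 B3 B4 : MixedUnitInterval} (h : AlignedCond A2 A3 B1 B3 B4) :
    (bigraphP' i).IsRepresentation (alignedModel i d c A2 A3 B1 B3 B4) := by
  obtain ⟨h1, h2, h3, h4, h5, h6, h7, h8, h9, h10, h11, h12⟩ := h
  have hi' : (1 : ℝ) ≤ i := by exact_mod_cast hi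
  have g1 := h4.le
  have g2 := h5.le
  have hc : ∀ k : ℕ, cc (k : ℝ) = ⟨k, true, true⟩ := fun k => rfl
  have ho : ∀ k : ℕ, co ((k : ℝ) + 1) = ⟨(k + 1 : ℕ), true, false⟩ := fun k => by simp [co]
  have k0 : ∀ k : ℕ, (0 : ℝ) ≤ k := fun k => k.cast_nonneg
  rw [isRepresentation_iff]
  constructor
  · rintro (_ | _ | _ | _ | _ | _ | _ | k | k | b) (_ | _ | _ | _ | _ | _ | _ | l | l | b') huv <;>
      simp only [Edge] at huv <;>
      simp only [alignedModel, hc, ho, meets_natCast_iff] <;>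
      first
        | assumption
        | (apply Meets.symm; assumption)
        | omega
        | (apply meets_of_lt <;> simp [oo, huv] <;> linarith)
        | simp [Meets, huv]
  · rintro (_ | _ | _ | _ | _ | _ | _ | k | k | b) (_ | _ | _ | _ | _ | _ | _ | l | l | b')
      hu hv huv hvu <;>
      simp only [Edge, side, reduceCtorEq, decide_eq_true_eq, decide_eq_false_iff_not,
        not_true_eq_false, not_false_eq_true] at hu hv huv hvu <;>
      simp only [alignedModel, hc, ho, meets_natCast_iff] <;>
      first
        | assumption
        | omega
        | (apply not_meets_of_lt; simp [oo]; linarith [k0 l])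
        -- Parity helps: a path index in `X` other than 0 is at least 2, while `b1` ends before 2
        -- because `a2`, which it meets, starts before 0. The bound on `i` in the next alternative
        -- plays the same role for the special vertices.
        | (have hk : 2 ≤ (k : ℕ) := by omega
           have hk : (2 : ℝ) ≤ (k : ℕ) := by exact_mod_cast hk
           apply not_meets_of_gt
           simp
           linarith)
        | (have hk : 2 ≤ i := by omega
           have hk : (2 : ℝ) ≤ i := by exact_mod_cast hk
           apply not_meets_of_gt
           simp
           linarith)
        | (have hl : 1 ≤ (l : ℕ) := by omega
           have hl : (1 : ℝ) ≤ (l : ℕ) := by exact_mod_cast hl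
           apply not_meets_of_lt
           simp
           linarith)
        | (simp only [Meets, oo]
           grind)
        | (have hl : 1 ≤ (l : ℕ) := by omega
           have hl : (1 : ℝ) ≤ (l : ℕ) := by exact_mod_cast hl
           simp only [Meets, oo]
           grind)
        | (have hk : 1 ≤ (k : ℕ) := by omega
           have hk : (1 : ℝ) ≤ (k : ℕ) := by exact_mod_cast hk
           apply not_meets_of_gt
           simp
           linarith)
        | (rintro (h | ⟨h, h'⟩ | ⟨h, h'⟩) <;> first | omega | cases h')

/-- The representations of `P'_1` that place the special vertices between `a3` and `a1`; only
the places of `b2`, `b3` and the path and some types are free. -/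
noncomputable def enclosedModel (d e : Bool) (P B2 B3 : MixedUnitInterval) :
    PVertex 1 → MixedUnitInterval
  | a1 => ⟨1, true, d⟩
  | a2 => ⟨-1, false, true⟩
  | a3 => .cc (-1)
  | b1 => .cc 0
  | b2 => B2
  | b3 => B3
  | b4 => ⟨-2, e, true⟩
  | path _ => P
  | pend _ => .oo 0
  | special _ => .oo 0

/-- The conditions on the free intervals of `enclosedModel`. -/
structure EnclosedCond (P B2 B3 : MixedUnitInterval) : Prop where
  p_gt : -1 < P.left
  p_lt : P.left < 1
  b3_gt : -2 < B3.left
  b3_lt : B3.left < 0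
  b2_gt : -2 < B2.left
  b2_le : B2.left ≤ 0
  b2_lc : B2.left = 0 → B2.leftClosed = true
  b2_rc : B2.left = 0 → B2.rightClosed = false
  pb2 : P.Meets B2
  pb3 : ¬ P.Meets B3

theorem isRepresentation_enclosedModel {d e : Bool} {P B2 B3 : MixedUnitInterval}
    (h : EnclosedCond P B2 B3) :
    (bigraphP' 1).IsRepresentation (enclosedModel d e P B2 B3) := by
  obtain ⟨h1, h2, h3, h4, h5, h6, h7, h8, h9, h10⟩ := h
  rw [isRepresentation_iff]
  constructor
  · rintro (_ | _ | _ | _ | _ | _ | _ | k | k | b) (_ | _ | _ | _ | _ | _ | _ | l | l | b') huv <;>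
      simp only [Edge] at huv <;>
      simp only [enclosedModel] <;>
      first
        | assumption
        | exact h9.symm
        | omega
        | exact k.elim0
        | exact l.elim0
        | (simp only [Meets, oo, cc]
           grind)
  · rintro (_ | _ | _ | _ | _ | _ | _ | k | k | b) (_ | _ | _ | _ | _ | _ | _ | l | l | b')
      hu hv huv hvu <;>
      simp only [Edge, side, reduceCtorEq, decide_eq_true_eq, decide_eq_false_iff_not,
        not_true_eq_false, not_false_eq_true] at hu hv huv hvu <;>
      simp only [enclosedModel] <;>
      first
        | assumption
        | omega
        | exact k.elim0
        | exact l.elim0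
        | (simp only [Meets, oo, cc]
           grind)

end PVertex

/-! ### Connecting the models within each family -/

namespace MixedUnitInterval

/-- The interval of the same type as `J` with left end `x`. -/
def moveTo (J : MixedUnitInterval) (x : ℝ) : MixedUnitInterval :=
  ⟨x, J.leftClosed, J.rightClosed⟩

theorem moveTo_left (J : MixedUnitInterval) (x : ℝ) : (J.moveTo x).left = x := rfl

end MixedUnitInterval

namespace PVertex

variable {i : ℕ} {d d' e e' : Bool} {c c' : Bool → Bool}

section Aligned

variable {A2 A3 B1 B3 B4 J : MixedUnitInterval}

/-- The disjoint pair `A2`, `B4` can only lie in this order, since `A2` starts after `-2` and `B4`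
before `-1`. The resulting chain is what guides the shifts below. -/
theorem AlignedCond.order (h : AlignedCond A2 A3 B1 B3 B4) :
    B1.left - 1 ≤ A3.left ∧ A3.left ≤ B4.left + 1 ∧ B4.left + 1 ≤ A2.left ∧
      A2.left ≤ B3.left + 1 := by
  have h1 := h.a2b1.le
  have h2 := h.a3b1.le
  have h3 := h.a2b3.le
  have h4 := h.a3b4.le
  have h5 := h.b1_gt
  have h6 := h.b4_lt
  refine ⟨by linarith, by linarith, ?_, by linarith⟩
  rcases le_or_le_of_not_meets h.a2b4 with h | h <;> linarith

/-- When the chain is strict no relevant ends touch, so the types of the free intervals play no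
role. -/
theorem alignedCond_of_lt (h1 : -1 < B1.left) (h2 : B1.left - 1 < A3.left)
    (h3 : A3.left < B4.left + 1) (h4 : B4.left + 1 < A2.left) (h5 : A2.left < B3.left + 1)
    (h6 : B3.left < -1) : AlignedCond A2 A3 B1 B3 B4 where
  b1_gt := h1
  a2_lt := by linarith
  a3_lt := by linarith
  a2b1 := meets_of_lt (by linarith) (by linarith)
  a3b1 := meets_of_lt (by linarith) (by linarith)
  a2b3 := meets_of_lt (by linarith) (by linarith)
  a3b3 := meets_of_lt (by linarith) (by linarith)
  a3b4 := meets_of_lt (by linarith) (by linarith)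
  a2b4 := not_meets_of_gt (by linarith)
  b3_le := h6.le
  b3_rc := fun h => absurd h h6.ne
  b4_lt := by linarith

theorem trivialEquiv_alignedModel_a2 (hi : 1 ≤ i) (h : AlignedCond A2 A3 B1 B3 B4)
    (h' : AlignedCond J A3 B1 B3 B4)
    (hJ : J.left = A2.left ∨ J.leftClosed = A2.leftClosed ∧ J.rightClosed = A2.rightClosed) :
    TrivialEquiv (bigraphP' i) (alignedModel i d c A2 A3 B1 B3 B4)
      (alignedModel i d c J A3 B1 B3 B4) := by
  refine TrivialEquiv.of_single (isRepresentation_alignedModel hi h)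
    (isRepresentation_alignedModel hi h') a2 hJ ?_
  rintro (_ | _) hw <;> first | rfl | exact absurd rfl hw

theorem trivialEquiv_alignedModel_a3 (hi : 1 ≤ i) (h : AlignedCond A2 A3 B1 B3 B4)
    (h' : AlignedCond A2 J B1 B3 B4)
    (hJ : J.left = A3.left ∨ J.leftClosed = A3.leftClosed ∧ J.rightClosed = A3.rightClosed) :
    TrivialEquiv (bigraphP' i) (alignedModel i d c A2 A3 B1 B3 B4)
      (alignedModel i d c A2 J B1 B3 B4) := by
  refine TrivialEquiv.of_single (isRepresentation_alignedModel hi h)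
    (isRepresentation_alignedModel hi h') a3 hJ ?_
  rintro (_ | _) hw <;> first | rfl | exact absurd rfl hw

theorem trivialEquiv_alignedModel_b1 (hi : 1 ≤ i) (h : AlignedCond A2 A3 B1 B3 B4)
    (h' : AlignedCond A2 A3 J B3 B4)
    (hJ : J.left = B1.left ∨ J.leftClosed = B1.leftClosed ∧ J.rightClosed = B1.rightClosed) :
    TrivialEquiv (bigraphP' i) (alignedModel i d c A2 A3 B1 B3 B4)
      (alignedModel i d c A2 A3 J B3 B4) := by
  refine TrivialEquiv.of_single (isRepresentation_alignedModel hi h)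
    (isRepresentation_alignedModel hi h') b1 hJ ?_
  rintro (_ | _) hw <;> first | rfl | exact absurd rfl hw

theorem trivialEquiv_alignedModel_b3 (hi : 1 ≤ i) (h : AlignedCond A2 A3 B1 B3 B4)
    (h' : AlignedCond A2 A3 B1 J B4)
    (hJ : J.left = B3.left ∨ J.leftClosed = B3.leftClosed ∧ J.rightClosed = B3.rightClosed) :
    TrivialEquiv (bigraphP' i) (alignedModel i d c A2 A3 B1 B3 B4)
      (alignedModel i d c A2 A3 B1 J B4) := by
  refine TrivialEquiv.of_single (isRepresentation_alignedModel hi h)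
    (isRepresentation_alignedModel hi h') b3 hJ ?_
  rintro (_ | _) hw <;> first | rfl | exact absurd rfl hw

theorem trivialEquiv_alignedModel_b4 (hi : 1 ≤ i) (h : AlignedCond A2 A3 B1 B3 B4)
    (h' : AlignedCond A2 A3 B1 B3 J)
    (hJ : J.left = B4.left ∨ J.leftClosed = B4.leftClosed ∧ J.rightClosed = B4.rightClosed) :
    TrivialEquiv (bigraphP' i) (alignedModel i d c A2 A3 B1 B3 B4)
      (alignedModel i d c A2 A3 B1 B3 J) := by
  refine TrivialEquiv.of_single (isRepresentation_alignedModel hi h)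
    (isRepresentation_alignedModel hi h') b4 hJ ?_
  rintro (_ | _) hw <;> first | rfl | exact absurd rfl hw

theorem trivialEquiv_alignedModel_types (hi : 1 ≤ i) (h : AlignedCond A2 A3 B1 B3 B4) :
    TrivialEquiv (bigraphP' i) (alignedModel i d c A2 A3 B1 B3 B4)
      (alignedModel i d' c' A2 A3 B1 B3 B4) := by
  have hr := fun d c => isRepresentation_alignedModel (d := d) (c := c) hi h
  -- The special vertices are retyped one at a time; the intermediate function has the new value at
  -- `true` and the old one at `false`.
  refine (TrivialEquiv.of_single (hr d c) (hr d' c) b2 (Or.inl rfl) ?_).trans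
    ((TrivialEquiv.of_single (hr d' c) (hr d' fun b => bif b then c' b else c b) (special true)
      (Or.inl rfl) ?_).trans
    (TrivialEquiv.of_single (hr d' fun b => bif b then c' b else c b) (hr d' c') (special false)
      (Or.inl rfl) ?_))
  · rintro (_ | _) hw <;> first | rfl | exact absurd rfl hw
  · rintro (_ | _ | _ | _ | _ | _ | _ | _ | _ | _ | _) hw <;> first | rfl | exact absurd rfl hw
  · rintro (_ | _ | _ | _ | _ | _ | _ | _ | _ | _ | _) hw <;> first | rfl | exact absurd rfl hw

/-- In the chain `B1 - 1 ≤ A3 ≤ B4 + 1 ≤ A2 ≤ B3 + 1` of left ends, the terms are sent to `-2 + δ,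
…, -2 + 5δ`. The bound on `δ` puts all targets below the whole old chain, so moving the terms in
this order never breaks it. -/
theorem trivialEquiv_alignedModel_moveTo (hi : 1 ≤ i) (h : AlignedCond A2 A3 B1 B3 B4) {δ : ℝ}
    (hδ : 0 < δ) (hδ' : 5 * δ < B1.left + 1) :
    TrivialEquiv (bigraphP' i) (alignedModel i d c A2 A3 B1 B3 B4)
      (alignedModel i d c (A2.moveTo (-2 + 4 * δ)) (A3.moveTo (-2 + 2 * δ))
        (B1.moveTo (-1 + δ)) (B3.moveTo (-3 + 5 * δ)) (B4.moveTo (-3 + 3 * δ))) := by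
  obtain ⟨o1, o2, o3, o4⟩ := h.order
  have o5 := h.b3_le
  have o6 := h.a2_lt
  have s1 : AlignedCond A2 A3 (B1.moveTo (-1 + δ)) B3 B4 :=
    { h with
      b1_gt := by rw [moveTo_left]; linarith
      a2b1 := by apply meets_of_lt <;> rw [moveTo_left] <;> linarith
      a3b1 := by apply meets_of_lt <;> rw [moveTo_left] <;> linarith }
  have s2 : AlignedCond A2 (A3.moveTo (-2 + 2 * δ)) (B1.moveTo (-1 + δ)) B3 B4 :=
    { s1 with
      a3_lt := by rw [moveTo_left]; linarith
      a3b1 := by apply meets_of_lt <;> simp only [moveTo_left] <;> linarith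
      a3b3 := by apply meets_of_lt <;> rw [moveTo_left] <;> linarith
      a3b4 := by apply meets_of_lt <;> rw [moveTo_left] <;> linarith }
  have s3 : AlignedCond A2 (A3.moveTo (-2 + 2 * δ)) (B1.moveTo (-1 + δ)) B3
      (B4.moveTo (-3 + 3 * δ)) :=
    { s2 with
      b4_lt := by rw [moveTo_left]; linarith
      a2b4 := by apply not_meets_of_gt; rw [moveTo_left]; linarith
      a3b4 := by apply meets_of_lt <;> simp only [moveTo_left] <;> linarith }
  have s4 : AlignedCond (A2.moveTo (-2 + 4 * δ)) (A3.moveTo (-2 + 2 * δ)) (B1.moveTo (-1 + δ)) B3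
      (B4.moveTo (-3 + 3 * δ)) :=
    { s3 with
      a2_lt := by rw [moveTo_left]; linarith
      a2b1 := by apply meets_of_lt <;> simp only [moveTo_left] <;> linarith
      a2b3 := by apply meets_of_lt <;> rw [moveTo_left] <;> linarith
      a2b4 := by apply not_meets_of_gt; simp only [moveTo_left]; linarith }
  have s5 : AlignedCond (A2.moveTo (-2 + 4 * δ)) (A3.moveTo (-2 + 2 * δ)) (B1.moveTo (-1 + δ))
      (B3.moveTo (-3 + 5 * δ)) (B4.moveTo (-3 + 3 * δ)) := by
    apply alignedCond_of_lt <;> simp only [moveTo_left] <;> linarith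
  exact (trivialEquiv_alignedModel_b1 hi h s1 (Or.inr ⟨rfl, rfl⟩)).trans <|
    (trivialEquiv_alignedModel_a3 hi s1 s2 (Or.inr ⟨rfl, rfl⟩)).trans <|
    (trivialEquiv_alignedModel_b4 hi s2 s3 (Or.inr ⟨rfl, rfl⟩)).trans <|
    (trivialEquiv_alignedModel_a2 hi s3 s4 (Or.inr ⟨rfl, rfl⟩)).trans <|
    trivialEquiv_alignedModel_b3 hi s4 s5 (Or.inr ⟨rfl, rfl⟩)

/-- With the free intervals in general position all types may be changed. -/
theorem trivialEquiv_alignedModel_retype (hi : 1 ≤ i) {A2' A3' B1' B3' B4' : MixedUnitInterval}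
    (h1 : -1 < B1.left) (h2 : B1.left - 1 < A3.left)
    (h3 : A3.left < B4.left + 1) (h4 : B4.left + 1 < A2.left) (h5 : A2.left < B3.left + 1)
    (h6 : B3.left < -1) (e1 : A2'.left = A2.left) (e2 : A3'.left = A3.left)
    (e3 : B1'.left = B1.left) (e4 : B3'.left = B3.left) (e5 : B4'.left = B4.left) :
    TrivialEquiv (bigraphP' i) (alignedModel i d c A2 A3 B1 B3 B4)
      (alignedModel i d' c' A2' A3' B1' B3' B4') := by
  have s0 : AlignedCond A2 A3 B1 B3 B4 := by apply alignedCond_of_lt <;> linarith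
  have s1 : AlignedCond A2' A3 B1 B3 B4 := by apply alignedCond_of_lt <;> linarith
  have s2 : AlignedCond A2' A3' B1 B3 B4 := by apply alignedCond_of_lt <;> linarith
  have s3 : AlignedCond A2' A3' B1' B3 B4 := by apply alignedCond_of_lt <;> linarith
  have s4 : AlignedCond A2' A3' B1' B3' B4 := by apply alignedCond_of_lt <;> linarith
  have s5 : AlignedCond A2' A3' B1' B3' B4' := by apply alignedCond_of_lt <;> linarith
  exact (trivialEquiv_alignedModel_a2 hi s0 s1 (Or.inl e1)).trans <|
    (trivialEquiv_alignedModel_a3 hi s1 s2 (Or.inl e2)).trans <|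
    (trivialEquiv_alignedModel_b1 hi s2 s3 (Or.inl e3)).trans <|
    (trivialEquiv_alignedModel_b3 hi s3 s4 (Or.inl e4)).trans <|
    (trivialEquiv_alignedModel_b4 hi s4 s5 (Or.inl e5)).trans <|
    trivialEquiv_alignedModel_types hi s5

/-- With one `δ` small enough for both, the two models are moved to the same left ends and differ
there only in types. -/
theorem trivialEquiv_alignedModel (hi : 1 ≤ i) {A2' A3' B1' B3' B4' : MixedUnitInterval}
    (h : AlignedCond A2 A3 B1 B3 B4) (h' : AlignedCond A2' A3' B1' B3' B4') :
    TrivialEquiv (bigraphP' i) (alignedModel i d c A2 A3 B1 B3 B4)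
      (alignedModel i d' c' A2' A3' B1' B3' B4') := by
  have hb := h.b1_gt
  have hb' := h'.b1_gt
  have hlt : B1.left < 1 := by linarith [h.order.1, h.a3_lt]
  obtain ⟨δ, hδ, hδ1⟩ : ∃ δ : ℝ, 0 < δ ∧ 5 * δ < min (B1.left + 1) (B1'.left + 1) := by
    have : 0 < min (B1.left + 1) (B1'.left + 1) := lt_min (by linarith) (by linarith)
    exact ⟨min (B1.left + 1) (B1'.left + 1) / 6, by linarith, by linarith⟩
  have hδ2 := hδ1.trans_le (min_le_left _ _)
  refine (trivialEquiv_alignedModel_moveTo hi h hδ hδ2).trans (TrivialEquiv.trans ?_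
    (trivialEquiv_alignedModel_moveTo hi h' hδ (hδ1.trans_le (min_le_right _ _))).symm)
  apply trivialEquiv_alignedModel_retype hi <;> simp only [moveTo_left] <;> linarith

end Aligned

section Enclosed

variable {P B2 B3 J : MixedUnitInterval}

theorem trivialEquiv_enclosedModel_path (h : EnclosedCond P B2 B3)
    (h' : EnclosedCond J B2 B3)
    (hJ : J.left = P.left ∨ J.leftClosed = P.leftClosed ∧ J.rightClosed = P.rightClosed) :
    TrivialEquiv (bigraphP' 1) (enclosedModel d e P B2 B3)
      (enclosedModel d e J B2 B3) := by
  refine TrivialEquiv.of_single (isRepresentation_enclosedModel h)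
    (isRepresentation_enclosedModel h') (path 0) hJ ?_
  rintro (_ | _ | _ | _ | _ | _ | _ | k | _ | _) hw <;>
    first | rfl | exact absurd (congrArg path (Subsingleton.elim k 0)) hw

theorem trivialEquiv_enclosedModel_b2 (h : EnclosedCond P B2 B3)
    (h' : EnclosedCond P J B3)
    (hJ : J.left = B2.left ∨ J.leftClosed = B2.leftClosed ∧ J.rightClosed = B2.rightClosed) :
    TrivialEquiv (bigraphP' 1) (enclosedModel d e P B2 B3)
      (enclosedModel d e P J B3) := by
  refine TrivialEquiv.of_single (isRepresentation_enclosedModel h)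
    (isRepresentation_enclosedModel h') b2 hJ ?_
  rintro (_ | _) hw <;> first | rfl | exact absurd rfl hw

theorem trivialEquiv_enclosedModel_b3 (h : EnclosedCond P B2 B3)
    (h' : EnclosedCond P B2 J)
    (hJ : J.left = B3.left ∨ J.leftClosed = B3.leftClosed ∧ J.rightClosed = B3.rightClosed) :
    TrivialEquiv (bigraphP' 1) (enclosedModel d e P B2 B3)
      (enclosedModel d e P B2 J) := by
  refine TrivialEquiv.of_single (isRepresentation_enclosedModel h)
    (isRepresentation_enclosedModel h') b3 hJ ?_
  rintro (_ | _) hw <;> first | rfl | exact absurd rfl hw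

theorem trivialEquiv_enclosedModel_types (h : EnclosedCond P B2 B3) :
    TrivialEquiv (bigraphP' 1) (enclosedModel d e P B2 B3) (enclosedModel d' e' P B2 B3) := by
  have hr := fun d e => isRepresentation_enclosedModel (d := d) (e := e) h
  refine (TrivialEquiv.of_single (hr d e) (hr d' e) a1 (Or.inl rfl) ?_).trans
    (TrivialEquiv.of_single (hr d' e) (hr d' e') b4 (Or.inl rfl) ?_)
  · rintro (_ | _) hw <;> first | rfl | exact absurd rfl hw
  · rintro (_ | _) hw <;> first | rfl | exact absurd rfl hw

theorem EnclosedCond.order (h : EnclosedCond P B2 B3) :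
    B3.left + 1 ≤ P.left ∧ P.left ≤ B2.left + 1 := by
  have h1 := h.p_gt
  have h2 := h.p_lt
  have h3 := h.b3_gt
  have h4 := h.b3_lt
  refine ⟨?_, h.pb2.le.1⟩
  rcases le_or_le_of_not_meets h.pb3 with h | h <;> linarith

theorem enclosedCond_of_lt (h1 : -2 < B3.left) (h2 : B3.left + 1 < P.left)
    (h3 : P.left < B2.left + 1) (h4 : B2.left < 0) (h5 : B2.left < P.left + 1) :
    EnclosedCond P B2 B3 where
  p_gt := by linarith
  p_lt := by linarith
  b3_gt := h1
  b3_lt := by linarith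
  b2_gt := by linarith
  b2_le := h4.le
  b2_lc := fun h => absurd h h4.ne
  b2_rc := fun h => absurd h h4.ne
  pb2 := meets_of_lt h3 h5
  pb3 := not_meets_of_gt h2

/-- The same device for the chain `B3 + 1 ≤ P ≤ B2 + 1`, sent to `-1 + δ, -1 + 2δ, -1 + 3δ`. -/
theorem trivialEquiv_enclosedModel_moveTo (h : EnclosedCond P B2 B3) {δ : ℝ}
    (hδ : 0 < δ) (hδ' : 3 * δ < B3.left + 2) :
    TrivialEquiv (bigraphP' 1) (enclosedModel d e P B2 B3)
      (enclosedModel d e (P.moveTo (-1 + 2 * δ)) (B2.moveTo (-2 + 3 * δ))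
        (B3.moveTo (-2 + δ))) := by
  obtain ⟨o1, o2⟩ := h.order
  have o3 := h.b3_lt
  have o4 := h.b2_le
  have s1 : EnclosedCond P B2 (B3.moveTo (-2 + δ)) :=
    { h with
      b3_gt := by rw [moveTo_left]; linarith
      b3_lt := by rw [moveTo_left]; linarith
      pb3 := by apply not_meets_of_gt; rw [moveTo_left]; linarith }
  have s2 : EnclosedCond (P.moveTo (-1 + 2 * δ)) B2 (B3.moveTo (-2 + δ)) :=
    { s1 with
      p_gt := by rw [moveTo_left]; linarith
      p_lt := by rw [moveTo_left]; linarith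
      pb2 := by apply meets_of_lt <;> rw [moveTo_left] <;> linarith
      pb3 := by apply not_meets_of_gt; simp only [moveTo_left]; linarith }
  have s3 : EnclosedCond (P.moveTo (-1 + 2 * δ)) (B2.moveTo (-2 + 3 * δ))
      (B3.moveTo (-2 + δ)) := by
    apply enclosedCond_of_lt <;> simp only [moveTo_left] <;> linarith
  exact (trivialEquiv_enclosedModel_b3 h s1 (Or.inr ⟨rfl, rfl⟩)).trans <|
    (trivialEquiv_enclosedModel_path s1 s2 (Or.inr ⟨rfl, rfl⟩)).trans <|
    trivialEquiv_enclosedModel_b2 s2 s3 (Or.inr ⟨rfl, rfl⟩)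

theorem trivialEquiv_enclosedModel {P' B2' B3' : MixedUnitInterval}
    (h : EnclosedCond P B2 B3) (h' : EnclosedCond P' B2' B3') :
    TrivialEquiv (bigraphP' 1) (enclosedModel d e P B2 B3) (enclosedModel d' e' P' B2' B3') := by
  have hb := h.b3_gt
  have hb' := h'.b3_gt
  have hlt := h.b3_lt
  obtain ⟨δ, hδ, hδ1⟩ : ∃ δ : ℝ, 0 < δ ∧ 3 * δ < min (B3.left + 2) (B3'.left + 2) := by
    have : 0 < min (B3.left + 2) (B3'.left + 2) := lt_min (by linarith) (by linarith)
    exact ⟨min (B3.left + 2) (B3'.left + 2) / 4, by linarith, by linarith⟩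
  have hδ2 := hδ1.trans_le (min_le_left _ _)
  refine (trivialEquiv_enclosedModel_moveTo h hδ hδ2).trans (TrivialEquiv.trans ?_
    (trivialEquiv_enclosedModel_moveTo h' hδ (hδ1.trans_le (min_le_right _ _))).symm)
  have s0 : EnclosedCond (P.moveTo (-1 + 2 * δ)) (B2.moveTo (-2 + 3 * δ))
      (B3.moveTo (-2 + δ)) := by
    apply enclosedCond_of_lt <;> simp only [moveTo_left] <;> linarith
  have s1 : EnclosedCond (P'.moveTo (-1 + 2 * δ)) (B2.moveTo (-2 + 3 * δ))
      (B3.moveTo (-2 + δ)) := by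
    apply enclosedCond_of_lt <;> simp only [moveTo_left] <;> linarith
  have s2 : EnclosedCond (P'.moveTo (-1 + 2 * δ)) (B2'.moveTo (-2 + 3 * δ))
      (B3.moveTo (-2 + δ)) := by
    apply enclosedCond_of_lt <;> simp only [moveTo_left] <;> linarith
  have s3 : EnclosedCond (P'.moveTo (-1 + 2 * δ)) (B2'.moveTo (-2 + 3 * δ))
      (B3'.moveTo (-2 + δ)) := by
    apply enclosedCond_of_lt <;> simp only [moveTo_left] <;> linarith
  exact (trivialEquiv_enclosedModel_path s0 s1 (Or.inl rfl)).trans <|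
    (trivialEquiv_enclosedModel_b2 s1 s2 (Or.inl rfl)).trans <|
    (trivialEquiv_enclosedModel_b3 s2 s3 (Or.inl rfl)).trans <|
    trivialEquiv_enclosedModel_types s3

end Enclosed

/-! ### The link between the two families for `i = 1` -/

theorem stdRep_eq_alignedModel (i : ℕ) (c : Bool → Bool) :
    stdRep i c = alignedModel i true c (.cc (-1 / 2)) (.cc (-1)) (.cc (-1 / 2)) (.cc (-3 / 2))
      (.cc (-2)) := by
  ext1 v
  rcases v with _ | _ | _ | _ | _ | _ | _ | _ | _ | b
  case special =>
    change (if c b then cc (i : ℝ) else co (i : ℝ)) = ⟨(i : ℝ), true, c b⟩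
    cases c b <;> rfl
  all_goals rfl

theorem alignedCond_std :
    AlignedCond (.cc (-1 / 2)) (.cc (-1)) (.cc (-1 / 2)) (.cc (-3 / 2)) (.cc (-2)) := by
  constructor <;> norm_num [Meets, cc]

/-- Permuting intervals keeps vertices with a common interval together. The standard model has `a2`
and `b1` on one interval, so `b1` is moved to `-1/4` to separate them; similarly `b2` is made
left-open in the link to part it from `a3`. -/
theorem alignedCond_relabel :
    AlignedCond (.cc (-1 / 2)) (.cc (-1)) (.cc (-1 / 4)) (.cc (-3 / 2)) (.cc (-2)) := by
  constructor <;> norm_num [Meets, cc]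

theorem enclosedCond_relabel :
    EnclosedCond (.cc (-1 / 4)) (.cc (-1 / 2)) (.cc (-3 / 2)) := by
  constructor <;> norm_num [Meets, cc]

/-- The two shapes of representations of `P'_1` have members with the same intervals. -/
theorem trivialEquiv_alignedModel_enclosedModel :
    TrivialEquiv (bigraphP' 1)
      (alignedModel 1 false (fun _ => true) (.cc (-1 / 2)) (.cc (-1)) (.cc (-1 / 4))
        (.cc (-3 / 2)) (.cc (-2)))
      (enclosedModel true true (.cc (-1 / 4)) (.cc (-1 / 2)) (.cc (-3 / 2))) := by
  classical
  -- The transpositions exchange the intervals of `a2` and `b2`, of `b1` and the path vertex, and of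
  -- `a1` and the two special vertices. The last is no permutation of vertices, since two vertices
  -- share that interval.
  refine .rel _ _ ⟨isRepresentation_alignedModel le_rfl alignedCond_relabel,
    isRepresentation_enclosedModel enclosedCond_relabel, .relabelIntervals
      (Equiv.swap ⟨-1, false, true⟩ (.cc (-1 / 2)) *
      Equiv.swap (.cc (-1 / 4)) (.cc 0) * Equiv.swap (.oo 0) (.cc 1)) ?_ ?_⟩
  · rintro (_ | _ | _ | _ | _ | _ | _ | k | k | b)
    case pend => exact k.elim0
    all_goals
      norm_num [alignedModel, enclosedModel, Equiv.Perm.mul_apply, Equiv.swap_apply_def, cc, oo]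
  · apply Subset.antisymm
    · rintro _ ⟨_ | _ | _ | _ | _ | _ | _ | k | k | b, rfl⟩
      · exact ⟨special true, by simp [alignedModel, enclosedModel]⟩
      · exact ⟨b2, rfl⟩
      · exact ⟨a3, rfl⟩
      · exact ⟨path 0, by simp [alignedModel, enclosedModel, cc]⟩
      · exact ⟨a2, rfl⟩
      · exact ⟨b3, rfl⟩
      · exact ⟨b4, rfl⟩
      · exact ⟨b1, rfl⟩
      · exact k.elim0
      · exact ⟨a1, rfl⟩
    · rintro _ ⟨_ | _ | _ | _ | _ | _ | _ | k | k | b, rfl⟩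
      · exact ⟨special true, rfl⟩
      · exact ⟨b2, rfl⟩
      · exact ⟨a3, rfl⟩
      · exact ⟨path 0, rfl⟩
      · exact ⟨a2, rfl⟩
      · exact ⟨b3, rfl⟩
      · exact ⟨b4, rfl⟩
      · exact ⟨b1, by simp [alignedModel, enclosedModel, cc, Subsingleton.elim k 0]⟩
      · exact k.elim0
      · exact ⟨a1, by simp [alignedModel, enclosedModel]⟩

end PVertex

/-! ### Every representation is a model after normalization -/

/-- If the intervals of `a` and `b` are disjoint, the model may be reflected and translated so
that `b` precedes `a` and `p` starts at `0`. -/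
theorem Bigraph.IsRepresentation.exists_normalized {V : Type*} {B : Bigraph V}
    {I : V → MixedUnitInterval} (h : B.IsRepresentation I) {a b : V} (hab : ¬ (I a).Meets (I b))
    (p : V) :
    ∃ I', TrivialEquiv B I I' ∧ B.IsRepresentation I' ∧ (I' b).left + 1 ≤ (I' a).left ∧
      (I' p).left = 0 := by
  obtain ⟨I', h1, h2, h3⟩ : ∃ I', TrivialEquiv B I I' ∧ B.IsRepresentation I' ∧
      (I' b).left + 1 ≤ (I' a).left := by
    rcases le_or_le_of_not_meets hab with hl | hl
    · refine ⟨_, TrivialEquiv.reflect h 0, h.reflect 0, ?_⟩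
      simp only [MixedUnitInterval.reflect]
      linarith
    · exact ⟨I, Relation.EqvGen.refl I, h, hl⟩
  refine ⟨_, h1.trans (TrivialEquiv.translate h2 (-(I' p).left)), h2.translate _, ?_, ?_⟩ <;>
    simp only [MixedUnitInterval.translate]
  · linarith
  · ring

namespace PVertex

variable {i : ℕ} {I : PVertex i → MixedUnitInterval}

theorem headPattern (h : (bigraphP' i).IsRepresentation I) (hi : 1 ≤ i) {w : PVertex i}
    (hw : Edge (path ⟨0, hi⟩) w) :
    HeadPattern (I a1) (I a2) (I a3) (I b1) (I b2) (I b3) (I b4) (I (path ⟨0, hi⟩)) (I w) := by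
  have hsw := side_ne_of_edge _ _ hw
  constructor
  case pw => exact meets_of_edge h hw
  case a1w | a2w | a3w =>
    refine not_meets_of_not_edge h hsw ?_ ?_ <;> cases w <;> simp_all [Edge]
  case pb3 | pb4 => exact not_meets_of_not_edge h (by simp [side]) (by simp [Edge]) (by simp [Edge])
  case pb1 | pb2 => exact (meets_of_edge h (by simp [Edge])).symm
  case a1b2 | a1b3 | a1b4 | a2b4 =>
    exact not_meets_of_not_edge h (by simp [side]) (by simp [Edge]) (by simp [Edge])
  all_goals exact (meets_of_edge h (by simp [Edge])).symm

theorem exists_edge_path {k : ℕ} (hk : k < i) : ∃ v, Edge (path ⟨k, hk⟩) v := by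
  by_cases h : k + 1 < i
  · exact ⟨path ⟨k + 1, h⟩, rfl⟩
  · exact ⟨special true, show k + 1 = i by omega⟩

/-- Whether `a1` and the first path vertex start together does not involve `w`, so the shape is the
same for all `w`. -/
theorem aligned_or_enclosed (h : (bigraphP' i).IsRepresentation I) (hi : 1 ≤ i)
    (h0 : (I b2).left + 1 ≤ (I a1).left) :
    (∀ w, Edge (path ⟨0, hi⟩) w →
      AlignedHead (I a1) (I a2) (I a3) (I b1) (I b2) (I b3) (I b4) (I (path ⟨0, hi⟩)) (I w)) ∨
    (i = 1 ∧ ∀ w, Edge (path ⟨0, hi⟩) w →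
      EnclosedHead (I a1) (I a2) (I a3) (I b1) (I b2) (I b3) (I b4) (I (path ⟨0, hi⟩)) (I w)) := by
  have key := fun w hw => (headPattern h hi (w := w) hw).aligned_or_enclosed h0
  by_cases he : (I a1).left = (I (path ⟨0, hi⟩)).left
  · refine Or.inl fun w hw => (key w hw).resolve_right fun hE => ?_
    linarith [hE.a1_left, hE.p_lt]
  · have hE := fun w hw => (key w hw).resolve_left fun hA => he hA.a1_left
    refine Or.inr ⟨?_, hE⟩
    by_contra hne
    have h1 : 1 < i := by omega
    -- For `i > 1` the second path vertex and the first pendant vertex would share an interval, but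
    -- the former has a further neighbour that the latter lacks.
    have e1 := hE (path ⟨1, h1⟩) rfl
    have e2 := hE (pend ⟨0, by omega⟩) rfl
    have heq : I (path ⟨1, h1⟩) = I (pend ⟨0, by omega⟩) := by
      ext
      · rw [e1.w_left, e2.w_left]
      · rw [e1.w_lc, e2.w_lc]
      · rw [e1.w_rc, e2.w_rc]
    obtain ⟨v, hv⟩ := exists_edge_path h1
    have hm := meets_of_edge h hv
    rw [heq] at hm
    refine not_meets_of_not_edge h ?_ ?_ ?_ hm
    · have := side_ne_of_edge _ _ hv
      simpa [side] using this
    · cases v <;> simp [Edge]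
    · clear hE
      cases v <;> simp_all [Edge]
      omega

/-- The pendant clause lags one index behind: the right end of a pendant interval is known only once
a forward neighbour of the next path vertex has been compared with it. -/
theorem path_eq_of_aligned (h : (bigraphP' i).IsRepresentation I) (hi : 1 ≤ i)
    (hA : ∀ w, Edge (path ⟨0, hi⟩) w →
      AlignedHead (I a1) (I a2) (I a3) (I b1) (I b2) (I b3) (I b4) (I (path ⟨0, hi⟩)) (I w))
    (hp : (I (path ⟨0, hi⟩)).left = 0) (k : ℕ) (hk : k < i) :
    I (path ⟨k, hk⟩) = .cc k ∧
      (∀ v, Edge (path ⟨k, hk⟩) v → (I v).left = k + 1 ∧ (I v).leftClosed = true) ∧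
      ∀ l : Fin (i - 1), (l : ℕ) + 1 = k → (I (pend l)).rightClosed = false := by
  induction k with
  | zero =>
    refine ⟨?_, fun v hv => ?_, fun l hl => by omega⟩
    · obtain ⟨v, hv⟩ := exists_edge_path hk
      ext
      · simpa [cc] using hp
      · exact (hA v hv).p_lc
      · exact (hA v hv).p_rc
    · refine ⟨?_, (hA v hv).w_lc⟩
      rw [(hA v hv).w_left, hp, Nat.cast_zero]
  | succ k ih =>
    obtain ⟨-, ih, -⟩ := ih (by omega)
    have hp := ih (path ⟨k + 1, hk⟩) rfl
    have hq := ih (pend ⟨k, by omega⟩) rfl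
    have key : ∀ v, Edge (path ⟨k + 1, hk⟩) v → _ := fun v hv =>
      touch_of_meets_of_not_meets (p := I (path ⟨k + 1, hk⟩)) (q := I (pend ⟨k, by omega⟩))
        (n := I v) (hp.1.trans hq.1.symm) hp.2 hq.2 (meets_of_edge h hv) <| by
          refine not_meets_of_not_edge h ?_ ?_ ?_
          · have := side_ne_of_edge _ _ hv
            intro h'
            apply this
            rw [← h']
            simp only [side]
            congr 1
            simp
            omega
          · cases v <;> simp [Edge]
          · cases v <;> simp_all [Edge]; omega
    obtain ⟨v, hv⟩ := exists_edge_path hk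
    refine ⟨?_, fun v hv => ?_, fun l hl => ?_⟩
    · ext
      · simpa [cc] using hp.1
      · exact hp.2
      · exact (key v hv).2.1
    · refine ⟨?_, (key v hv).2.2.1⟩
      rw [(key v hv).1, hp.1]
      push_cast
      ring
    · have hl' : l = ⟨k, by omega⟩ := Fin.ext (by simpa using hl)
      rw [hl']
      exact (key v hv).2.2.2

theorem eq_alignedModel (h : (bigraphP' i).IsRepresentation I) (hi : 1 ≤ i)
    (hA : ∀ w, Edge (path ⟨0, hi⟩) w →
      AlignedHead (I a1) (I a2) (I a3) (I b1) (I b2) (I b3) (I b4) (I (path ⟨0, hi⟩)) (I w))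
    (hp : (I (path ⟨0, hi⟩)).left = 0) :
    I = alignedModel i (I b2).leftClosed (fun b => (I (special b)).rightClosed)
        (I a2) (I a3) (I b1) (I b3) (I b4) ∧
      AlignedCond (I a2) (I a3) (I b1) (I b3) (I b4) := by
  have hpath := path_eq_of_aligned h hi hA hp
  obtain ⟨w, hw⟩ := exists_edge_path (k := 0) hi
  have hHw := hA w hw
  have ha1 : I a1 = .oo 0 := by
    ext
    · rw [hHw.a1_left, hp]; rfl
    · exact hHw.a1_lc
    · exact hHw.a1_rc
  have hb2 : I b2 = ⟨-1, (I b2).leftClosed, true⟩ := by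
    ext
    · rw [hHw.b2_left, hp]; norm_num
    · rfl
    · exact hHw.b2_rc
  constructor
  · ext1 v
    rcases v with _ | _ | _ | _ | _ | _ | _ | k | k | b
    case a1 => exact ha1
    case b2 => exact hb2
    case path => exact (hpath k k.2).1
    case pend =>
      have h1 := (hpath k (by omega)).2.1 (pend k) rfl
      ext
      · exact h1.1
      · exact h1.2
      · exact (hpath (k + 1) (by omega)).2.2 k rfl
    case special =>
      -- The last path vertex `u` has index `i - 1`.
      have h1 := (hpath (i - 1) (by omega)).2.1 (special b) (show i - 1 + 1 = i by omega)
      ext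
      · rw [h1.1]
        have : ((i - 1 : ℕ) : ℝ) + 1 = ((i - 1 + 1 : ℕ) : ℝ) := by push_cast; ring
        rw [this, Nat.sub_add_cancel hi]
        rfl
      · exact h1.2
      · rfl
    all_goals rfl
  · have hP := headPattern h hi hw
    have p0 : I (path ⟨0, hi⟩) = .cc 0 := by simpa using (hpath 0 hi).1
    rw [ha1, hb2, p0] at hP
    rw [ha1, hb2, p0] at hHw
    have b1_gt : -1 < (I b1).left := by
      have h1 := hP.a1b1
      simp only [Meets, oo] at h1
      grind
    have l1 := hP.a2b1.le
    have l2 := hP.a3b1.le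
    have l3 := hP.a3b4.le
    have l4 := hP.a2b3.le
    have l5 := hP.a2b2.le
    have l6 := hP.a3b2.le
    have hw1 : (I w).left = 1 := by rw [hHw.w_left]; simp [cc]
    have hwc := hHw.w_lc
    have a3_le : (I a3).left ≤ 0 := by
      rcases le_or_le_of_not_meets hP.a3w with h | h <;> linarith
    have a2_le : (I a2).left ≤ 0 := by
      rcases le_or_le_of_not_meets hP.a2w with h | h <;> linarith
    -- A contact of `a3` with `b4` at an end of `p = [0, 1]` would make `p`, closed at both ends,
    -- meet `b4`; likewise for `a2` and `b3`. This also gives the strict bounds below.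
    have b4_le : (I b4).left ≤ -1 := by
      rcases le_or_le_of_not_meets hP.pb4 with h | h <;> simp only [cc] at h
      · have c1 := hP.a3b4.closed
        have c2 := not_closed_of_not_meets hP.a3w
        have c3 := not_closed_of_not_meets hP.pb4
        simp only [cc] at c3
        grind
      · linarith
    have b3_le : (I b3).left ≤ -1 := by
      rcases le_or_le_of_not_meets hP.pb3 with h | h <;> simp only [cc] at h
      · have c1 := hP.a2b3.closed
        have c2 := not_closed_of_not_meets hP.a2w
        have c3 := not_closed_of_not_meets hP.pb3
        simp only [cc] at c3
        grind
      · linarith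
    have a3_lt : (I a3).left < 0 := by
      have c1 := hP.a3b4.closed
      have c3 := not_closed_of_not_meets hP.pb4
      simp only [cc] at c3
      grind
    have a2_lt : (I a2).left < 0 := by
      have c1 := hP.a2b3.closed
      have c3 := not_closed_of_not_meets hP.pb3
      simp only [cc] at c3
      grind
    refine ⟨b1_gt, a2_lt, a3_lt, hP.a2b1, hP.a3b1, hP.a2b3, hP.a3b3, hP.a3b4, hP.a2b4, b3_le,
      ?_, ?_⟩
    · have c3 := not_closed_of_not_meets hP.pb3
      simp only [cc] at c3
      grind
    · rcases le_or_le_of_not_meets hP.a2b4 with h | h <;> linarith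

theorem eq_enclosedModel {I : PVertex 1 → MixedUnitInterval}
    (h : (bigraphP' 1).IsRepresentation I)
    (hE : ∀ w, Edge (path ⟨0, Nat.one_pos⟩) w →
      EnclosedHead (I a1) (I a2) (I a3) (I b1) (I b2) (I b3) (I b4)
        (I (path ⟨0, Nat.one_pos⟩)) (I w))
    (ha : (I a3).left = -1) :
    I = enclosedModel (I a1).rightClosed (I b4).leftClosed (I (path 0)) (I b2) (I b3) ∧
      EnclosedCond (I (path 0)) (I b2) (I b3) := by
  have hs := fun b => hE (special b) rfl
  have h1 := hs true
  have hP := headPattern h le_rfl (w := special true) rfl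
  constructor
  · ext1 v
    rcases v with _ | _ | _ | _ | _ | _ | _ | k | k | b
    case pend => exact k.elim0
    case path => rw [Subsingleton.elim k 0]; rfl
    case a1 => ext; exacts [by rw [h1.a1_left, ha]; norm_num [enclosedModel], h1.a1_lc, rfl]
    case a2 => ext; exacts [by rw [h1.a2_left, ha]; rfl, h1.a2_lc, h1.a2_rc]
    case a3 => ext; exacts [ha, h1.a3_lc, h1.a3_rc]
    case b1 => ext; exacts [by rw [h1.b1_left, ha]; norm_num [enclosedModel, cc], h1.b1_lc,
      h1.b1_rc]
    case b4 => ext; exacts [by rw [h1.b4_left, ha]; norm_num [enclosedModel], rfl, h1.b4_rc]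
    case special =>
      ext; exacts [by rw [(hs b).w_left, ha]; norm_num [enclosedModel, oo], (hs b).w_lc,
        (hs b).w_rc]
    all_goals rfl
  · have e1 := h1.a1_left
    have e3 : _ < (I (path 0)).left := h1.p_gt
    have e4 : (I (path 0)).left < _ := h1.p_lt
    have e5 := h1.b3_gt
    have e6 : _ ≤ (I (path 0)).left - 1 := h1.b3_le
    have e7 := h1.b2_le
    have l1 : (I (path 0)).left ≤ _ ∧ _ := hP.pb2.le
    rw [ha] at e1 e3 e4 e5 e7
    refine ⟨e3, by linarith, by linarith, by linarith, by linarith [l1.1], by linarith,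
      fun hb => ?_, fun hb => ?_, hP.pb2, hP.pb3⟩
    -- If `b2` starts at 0, it touches `a2`, which it meets, at 0, and the left-closed `a1`, which
    -- it misses, at 1.
    · exact (hP.a2b2.closed.1 (by rw [hb, h1.a2_left, ha]; norm_num)).2
    · have := (not_closed_of_not_meets hP.a1b2).2 (by rw [hb, e1]; norm_num)
      simpa [h1.a1_lc] using this

end PVertex

/-! ### Uniqueness for `P'_i` and the obstruction in `P_i` -/

namespace PVertex

variable {i : ℕ}

theorem not_meets_a1_b2 {I : PVertex i → MixedUnitInterval}
    (h : (bigraphP' i).IsRepresentation I) : ¬ (I a1).Meets (I b2) :=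
  not_meets_of_not_edge h (by simp [side]) (by simp [Edge]) (by simp [Edge])

theorem isRepresentation_stdRep (hi : 1 ≤ i) (c : Bool → Bool) :
    (bigraphP' i).IsRepresentation (stdRep i c) := by
  rw [stdRep_eq_alignedModel]
  exact isRepresentation_alignedModel hi alignedCond_std

/-- Every representation of `P'_i` agrees with the standard one up to trivial modifications. -/
theorem trivialEquiv_stdRep (hi : 1 ≤ i) (c : Bool → Bool) {I : PVertex i → MixedUnitInterval}
    (h : (bigraphP' i).IsRepresentation I) :
    TrivialEquiv (bigraphP' i) (stdRep i c) I := by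
  rw [stdRep_eq_alignedModel]
  obtain ⟨J, hIJ, hJ, h0, hp⟩ := h.exists_normalized (not_meets_a1_b2 h) (path ⟨0, hi⟩)
  refine TrivialEquiv.trans ?_ hIJ.symm
  rcases aligned_or_enclosed hJ hi h0 with hA | ⟨rfl, hE⟩
  · obtain ⟨he, hc⟩ := eq_alignedModel hJ hi hA hp
    rw [he]
    exact trivialEquiv_alignedModel hi alignedCond_std hc
  · obtain ⟨K, hJK, hK, h0, ha, hne⟩ : ∃ K, TrivialEquiv (bigraphP' 1) J K ∧
        (bigraphP' 1).IsRepresentation K ∧ (K b2).left + 1 ≤ (K a1).left ∧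
        (K a3).left = -1 ∧ (K a1).left ≠ (K (path ⟨0, hi⟩)).left := by
      have h1 := hE (special true) rfl
      have h2 := h1.a1_left
      have h3 := h1.p_lt
      refine ⟨_, TrivialEquiv.translate hJ (-(J a3).left - 1), hJ.translate _, ?_, ?_, ?_⟩ <;>
        simp only [MixedUnitInterval.translate]
      · linarith
      · ring
      · intro h
        linarith
    -- Only in the enclosed shape do `a1` and the path vertex start at different points, a property
    -- that survives translation.
    have hE := (aligned_or_enclosed hK hi h0).resolve_left fun hA =>
      hne (hA (special true) rfl).a1_left
    obtain ⟨he, hc⟩ := eq_enclosedModel hK hE.2 ha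
    refine TrivialEquiv.trans ?_ hJK.symm
    rw [he]
    exact (trivialEquiv_alignedModel hi alignedCond_std alignedCond_relabel).trans
      (trivialEquiv_alignedModel_enclosedModel.trans
        (trivialEquiv_enclosedModel enclosedCond_relabel hc))

end PVertex

theorem PEdge.adj {i : ℕ} {u v : PVertex i ⊕ Bool} (h : PEdge u v) :
    (bigraphP i).graph.Adj u v := by
  refine ⟨?_, Or.inl h⟩
  rintro rfl
  exact PSide_ne_of_edge u u h rfl

open PVertex in
/-- `P_i` has no representation by mixed unit intervals. -/
theorem not_isMixedUnitInterval_bigraphP {i : ℕ} (hi : 1 ≤ i) :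
    ¬ (bigraphP i).IsMixedUnitInterval := by
  rintro ⟨I, hI⟩
  have hsub : ∀ {I}, (bigraphP i).IsRepresentation I →
      (bigraphP' i).IsRepresentation (I ∘ Sum.inl) := fun h =>
    h.comp (fun u v => by simp [bigraphP, bigraphP', PEdge]) (fun u v => Iff.rfl)
  -- All of `P_i` is normalized, so that the two extra pendant vertices move along.
  obtain ⟨J, -, hJ, h0, hp⟩ := hI.exists_normalized (a := .inl a1) (b := .inl b2)
    (not_meets_a1_b2 (hsub hI)) (.inl (path ⟨0, hi⟩))
  have hz : ∀ b, (J (.inl (special b))).Meets (J (.inr b)) := fun b =>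
    ((Bigraph.isRepresentation_iff.1 hJ _ _).1 (PEdge.adj (u := .inl (special b)) (v := .inr b)
      rfl)).2
  have hz' : ∀ b, ¬ (J (.inl (special !b))).Meets (J (.inr b)) := by
    intro b hm
    have := (Bigraph.isRepresentation_iff.1 hJ (.inl (special !b)) (.inr b)).2 ⟨?_, hm⟩
    · simp [bigraphP, PEdge] at this
    · simp only [bigraphP, PSide, PVertex.side]
      intro h
      simp at h
      omega
  rcases aligned_or_enclosed (hsub hJ) hi h0 with hA | ⟨rfl, hE⟩
  · have he := (eq_alignedModel (hsub hJ) hi hA hp).1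
    have hs : ∀ b, (J (.inl (special b))).left = i ∧ (J (.inl (special b))).leftClosed = true :=
      fun b => by
        have := congrFun he (special b)
        simp only [Function.comp_apply, alignedModel] at this
        rw [this]
        exact ⟨rfl, rfl⟩
    -- The private neighbour of each special vertex makes that vertex right-closed and the other
    -- right-open.
    have key := fun b => touch_of_meets_of_not_meets ((hs b).1.trans (hs !b).1.symm) (hs b).2
      (hs !b).2 (hz b) (hz' b)
    have h1 := (key true).2.1
    have h2 := (key false).2.2.2
    simp only [Bool.not_false] at h2
    rw [h1] at h2
    cases h2
  · have e1 := hE (special true) rfl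
    have e2 := hE (special false) rfl
    have heq : J (.inl (special true)) = J (.inl (special false)) := by
      ext
      · exact e1.w_left.trans e2.w_left.symm
      · exact e1.w_lc.trans e2.w_lc.symm
      · exact e1.w_rc.trans e2.w_rc.symm
    exact hz' false (by simpa [heq] using hz false)

open PVertex in
/-- Any two bipartitions of `P_i` agree up to exchanging the partite sets. -/
theorem ne_iff_PSide_ne {i : ℕ} (hi : 1 ≤ i) {s : PVertex i ⊕ Bool → Bool}
    (hs : ∀ u v, (bigraphP i).graph.Adj u v → s u ≠ s v) (u v : PVertex i ⊕ Bool) :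
    PSide u ≠ PSide v ↔ s u ≠ s v := by
  have step : ∀ {u v}, PEdge u v → (s u == PSide u) = (s v == PSide v) := by
    -- Agreement of `s` with `PSide` is constant along edges, hence on the connected graph `P_i`.
    intro u v h
    have h1 := hs u v h.adj
    have h2 := PSide_ne_of_edge u v h
    revert h1 h2
    cases s u <;> cases s v <;> cases PSide u <;> cases PSide v <;> simp
  have hpath : ∀ k (hk : k < i), (s (.inl (path ⟨k, hk⟩)) == PSide (.inl (path ⟨k, hk⟩))) =
      (s (.inl (path ⟨0, hi⟩)) == PSide (.inl (path ⟨0, hi⟩))) := by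
    intro k hk
    induction k with
    | zero => rfl
    | succ k ih =>
      rw [← ih (by omega)]
      exact (step (u := .inl (path ⟨k, by omega⟩)) (v := .inl (path ⟨k + 1, hk⟩)) rfl).symm
  have key : ∀ v : PVertex i ⊕ Bool, (s v == PSide v) =
      (s (.inl (path ⟨0, hi⟩)) == PSide (.inl (path ⟨0, hi⟩))) := by
    have hb1 := step (u := .inl b1) (v := .inl (path ⟨0, hi⟩)) rfl
    have hb2 := step (u := .inl b2) (v := .inl (path ⟨0, hi⟩)) rfl
    have ha2 := (step (u := .inl b1) (v := .inl a2) trivial).symm.trans hb1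
    have ha3 := (step (u := .inl b1) (v := .inl a3) trivial).symm.trans hb1
    have hsp : ∀ b, _ := fun b => (step (u := .inl (path ⟨i - 1, by omega⟩))
      (v := .inl (special b)) (show i - 1 + 1 = i by omega)).symm.trans (hpath _ _)
    rintro ((_ | _ | _ | _ | _ | _ | _ | k | k | b) | b)
    · exact (step (u := .inl b1) (v := .inl a1) trivial).symm.trans hb1
    · exact ha2
    · exact ha3
    · exact hb1
    · exact hb2
    · exact (step (u := .inl b3) (v := .inl a2) trivial).trans ha2
    · exact (step (u := .inl b4) (v := .inl a3) trivial).trans ha3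
    · exact hpath k k.2
    · exact (step (u := .inl (path ⟨k, by omega⟩)) (v := .inl (pend k)) rfl).symm.trans
        (hpath k _)
    · exact hsp b
    · exact (step (u := .inl (special b)) (v := .inr b) rfl).symm.trans (hsp b)
  have huv := (key u).trans (key v).symm
  revert huv
  cases s u <;> cases s v <;> cases PSide u <;> cases PSide v <;> simp

theorem lemma5 (i : ℕ) (hi : 1 ≤ i) :
    (∀ c : Bool → Bool,
      (bigraphP' i).IsRepresentation (PVertex.stdRep i c) ∧
      ∀ I : PVertex i → MixedUnitInterval, (bigraphP' i).IsRepresentation I →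
        TrivialEquiv (bigraphP' i) (PVertex.stdRep i c) I) ∧
    (¬ (bigraphP i).IsMixedUnitInterval ∧
      ∀ (W : Type*) (B : Bigraph W), B.IsMixedUnitInterval →
        ¬ (bigraphP i).graph.IsIndContained B.graph) := by
  refine ⟨fun c => ⟨PVertex.isRepresentation_stdRep hi c,
    fun I hI => PVertex.trivialEquiv_stdRep hi c hI⟩, not_isMixedUnitInterval_bigraphP hi, ?_⟩
  rintro W B ⟨I, hI⟩ ⟨f⟩
  exact not_isMixedUnitInterval_bigraphP hi ⟨I ∘ f, hI.comp (fun u v => f.map_adj_iff.symm)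
    (ne_iff_PSide_ne hi fun u v h => B.bipartite (f.map_adj_iff.2 h))⟩
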